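/- **Theorem 4.1.** Let $r>0$ and $m_2\in\mathbb N$, let $L_2^{m_2}(0,r)$ be the Hilbert space of square integrable $\mathbb C^{m_2}$-valued functions on $(0,r)$, and let $\mathcal A$ be the bounded operator $(\mathcal A f)(x)=\mathrm i\int_0^x f(t)\,dt$ on it. Let $T$ be a bounded operator on $L_2^{m_2}(0,r)$ such that $$T\mathcal A+\mathcal A^*T=\widetilde Z,\qquad (\widetilde Z f)(x)=\int_0^r\widetilde{\mathcal Z}(x,t)f(t)\,dt ,$$ where $\widetilde Z$ is a bounded integral operator with a measurable $m_2\times m_2$ matrix kernel $\widetilde{\mathcal Z}$ (for each $f\in L_2^{m_2}(0,r)$ the integral converges absolutely for almost every $x$). Then $T$ admits the representation $$T=\frac{d}{dx}\int_0^r\frac{\partial\widetilde\Upsilon}{\partial t}(x,t)\,\cdot\,dt ,$$ that is, for every $f\in L_2^{m_2}(0,r)$ the function $x\mapsto\int_0^r\frac{\partial\widetilde\Upsilon}{\partial t}(x,t)f(t)\,dt$ is absolutely continuous on $[0,r]$ and its derivative equals $Tf$ almost everywhere. Here $\widetilde\Upsilon$ is an $m_2\times m_2$ matrix function such that, for every $x\in[0,r]$,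 $\widetilde\Upsilon(x,\cdot)$ is absolutely continuous on $[0,r]$ with $\frac{\partial}{\partial t}\widetilde\Upsilon(x,\cdot)\in L_2^{m_2\times m_2}(0,r)$, and, for every $x\in[0,r]$ and almost every $t\in(0,r)$, $$\widetilde\Upsilon(x,t)=\widetilde\upsilon(x+t)+\frac{\mathrm i}{2}\int_{-\min\{x+t,\,2r-x-t\}}^{x-t}\widetilde{\mathcal Z}\Big(\frac{x+t+s}{2},\frac{x+t-s}{2}\Big)ds ,$$ with an absolutely convergent integral, where $\widetilde\upsilon\in L_2^{m_2\times m_2}(0,r)$ and $\widetilde\upsilon(\xi)=0$ for $r\le\xi\le 2r$. Moreover, for almost every $\xi\in[r,2r]$ the following integral converges absolutely and $$\int_{\xi-r}^{r}\widetilde{\mathcal Z}(\xi-t,t)\,dt=0 .$$ If, in addition, $\widetilde{\mathcal Z}$ is bounded on $[0,r]^2$ and continuous there off the diagonal $x=t$ (in particular, if it is continuous on $[0,r]^2$), then $\widetilde\upsilon$ and $\widetilde\Upsilon$ may be chosen so that the formula for $\widetilde\Upsilon$ holds for all $x,t\in[0,r]$, and the last equality holds for all $\xi\in[r,2r]$.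 -/

import Mathlib

open MeasureTheory Set
open scoped ENNReal

/-- Lebesgue measure on the interval `(0, r)`. -/
noncomputable abbrev intervalMeasure (r : ℝ) : Measure ℝ := volume.restrict (Ioo 0 r)

/-- The Hilbert space `L₂^m(0, r)` of square integrable `ℂ^m`-valued functions on `(0, r)`. -/
abbrev L2Vec (m : ℕ) (r : ℝ) : Type := Lp (EuclideanSpace ℂ (Fin m)) 2 (intervalMeasure r)

theorem L2Vec.integrable {m : ℕ} {r : ℝ} (f : L2Vec m r) :
    Integrable (fun t => f t) (intervalMeasure r) :=
  (Lp.memLp f).integrable (by norm_num)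

theorem L2Vec.integrableOn_Ioc {m : ℕ} {r x : ℝ} (f : L2Vec m r) (hx : x < r) :
    IntegrableOn (fun t => f t) (Ioc 0 x) volume :=
  IntegrableOn.mono_set (t := Ioo 0 r) f.integrable
    (fun _ ht => ⟨ht.1, lt_of_le_of_lt ht.2 hx⟩)

theorem L2Vec.integral_norm_le {m : ℕ} {r : ℝ} (f : L2Vec m r) :
    ∫ t, ‖f t‖ ∂(intervalMeasure r) ≤ ‖f‖ * (intervalMeasure r univ ^ (1 / 2 : ℝ)).toReal := by
  have h := eLpNorm_le_eLpNorm_mul_rpow_measure_univ (μ := intervalMeasure r) (p := 1) (q := 2)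
    (by norm_num) (Lp.aestronglyMeasurable f)
  have hfin : eLpNorm (fun t => f t) 2 (intervalMeasure r) *
      intervalMeasure r univ ^ (1 / 2 : ℝ) ≠ ∞ :=
    ENNReal.mul_ne_top (Lp.memLp f).eLpNorm_ne_top
      (ENNReal.rpow_ne_top_of_nonneg (by norm_num) (measure_ne_top _ _))
  have e : (1 / ENNReal.toReal 1 - 1 / ENNReal.toReal 2 : ℝ) = 1 / 2 := by norm_num
  rw [e] at h
  rw [integral_norm_eq_lintegral_enorm (Lp.aestronglyMeasurable f), ← eLpNorm_one_eq_lintegral_enorm,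
    Lp.norm_def, ← ENNReal.toReal_mul]
  exact ENNReal.toReal_mono hfin h

/-- The primitive `x ↦ i ∫₀ˣ f(t) dt`. -/
noncomputable def volterraFun {m : ℕ} {r : ℝ} (f : L2Vec m r) (x : ℝ) :
    EuclideanSpace ℂ (Fin m) :=
  Complex.I • ∫ t in (0 : ℝ)..x, f t

theorem volterraFun_continuousOn {m : ℕ} {r : ℝ} (f : L2Vec m r) :
    ContinuousOn (volterraFun f) (Ioo 0 r) := by
  intro x hx
  have hr : 0 ≤ r := (hx.1.trans hx.2).le
  have h : ContinuousOn (fun x => ∫ t in (0 : ℝ)..x, f t) (uIcc 0 r) :=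
    intervalIntegral.continuousOn_primitive_interval' (μ := volume) (b₁ := 0) (b₂ := r)
      ((intervalIntegrable_iff_integrableOn_Ioo_of_le hr).2 f.integrable) left_mem_uIcc
  rw [uIcc_of_le hr] at h
  exact ((h x (Ioo_subset_Icc_self hx)).mono Ioo_subset_Icc_self).const_smul Complex.I

theorem volterraFun_aestronglyMeasurable {m : ℕ} {r : ℝ} (f : L2Vec m r) :
    AEStronglyMeasurable (volterraFun f) (intervalMeasure r) :=
  (volterraFun_continuousOn f).aestronglyMeasurable measurableSet_Ioo

theorem volterraFun_bound {m : ℕ} {r : ℝ} (f : L2Vec m r) :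
    ∀ᵐ x ∂(intervalMeasure r),
      ‖volterraFun f x‖ ≤ ‖f‖ * (intervalMeasure r univ ^ (1 / 2 : ℝ)).toReal := by
  filter_upwards [ae_restrict_mem measurableSet_Ioo] with x hx
  refine le_trans ?_ f.integral_norm_le
  rw [volterraFun, norm_smul, Complex.norm_I, one_mul, intervalIntegral.integral_of_le hx.1.le]
  refine (norm_integral_le_integral_norm _).trans ?_
  exact setIntegral_mono_set (s := Ioc 0 x) (t := Ioo 0 r) f.integrable.norm
    (Filter.Eventually.of_forall fun _ => norm_nonneg _)
    (LE.le.eventuallyLE fun _ ht => ⟨ht.1, lt_of_le_of_lt ht.2 hx.2⟩)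

theorem volterraFun_memLp {m : ℕ} {r : ℝ} (f : L2Vec m r) :
    MemLp (volterraFun f) 2 (intervalMeasure r) :=
  MemLp.of_bound (volterraFun_aestronglyMeasurable f) _ (volterraFun_bound f)

/-- The bounded operator `𝒜 = i ∫₀ˣ · dt` on `L₂^m(0, r)`. -/
noncomputable def volterraOp (m : ℕ) (r : ℝ) : L2Vec m r →L[ℂ] L2Vec m r :=
  LinearMap.mkContinuous
    { toFun := fun f => (volterraFun_memLp f).toLp (volterraFun f)
      map_add' := by
        intro f g
        rw [← MemLp.toLp_add, MemLp.toLp_eq_toLp_iff]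
        filter_upwards [ae_restrict_mem measurableSet_Ioo] with x hx
        have hadd : ∀ᵐ t ∂(volume.restrict (Ioc 0 x)), (f + g) t = f t + g t :=
          ae_restrict_of_ae_restrict_of_subset (s := Ioc 0 x) (t := Ioo 0 r)
            (fun _ ht => ⟨ht.1, lt_of_le_of_lt ht.2 hx.2⟩) (Lp.coeFn_add f g)
        simp only [volterraFun, Pi.add_apply, intervalIntegral.integral_of_le hx.1.le]
        rw [integral_congr_ae hadd,
          integral_add (f.integrableOn_Ioc hx.2) (g.integrableOn_Ioc hx.2), smul_add]
      map_smul' := by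
        intro c f
        rw [RingHom.id_apply, ← MemLp.toLp_const_smul, MemLp.toLp_eq_toLp_iff]
        filter_upwards [ae_restrict_mem measurableSet_Ioo] with x hx
        have hsmul : ∀ᵐ t ∂(volume.restrict (Ioc 0 x)), (c • f) t = c • f t :=
          ae_restrict_of_ae_restrict_of_subset (s := Ioc 0 x) (t := Ioo 0 r)
            (fun _ ht => ⟨ht.1, lt_of_le_of_lt ht.2 hx.2⟩) (Lp.coeFn_smul c f)
        simp only [volterraFun, Pi.smul_apply, intervalIntegral.integral_of_le hx.1.le]
        rw [integral_congr_ae hsmul, integral_smul, smul_comm] }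
    (((measureUnivNNReal (intervalMeasure r) : ℝ) ^ (ENNReal.toReal 2)⁻¹) *
      (intervalMeasure r univ ^ (1 / 2 : ℝ)).toReal)
    (by
      intro f
      have h := Lp.norm_le_of_ae_bound (f := (volterraFun_memLp f).toLp (volterraFun f))
        (C := ‖f‖ * (intervalMeasure r univ ^ (1 / 2 : ℝ)).toReal) (by positivity)
        (by
          filter_upwards [(volterraFun_memLp f).coeFn_toLp, volterraFun_bound f] with x h1 h2
          rw [h1]; exact h2)
      refine h.trans (le_of_eq ?_)
      ring)

theorem volterraOp_ae_eq {m : ℕ} {r : ℝ} (f : L2Vec m r) :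
    ∀ᵐ x ∂(intervalMeasure r), volterraOp m r f x = Complex.I • ∫ t in (0 : ℝ)..x, f t :=
  (volterraFun_memLp f).coeFn_toLp

/-- `K` is the integral operator `(K f)(x) = ∫₀ʳ k(x,t) f(t) dt` with the measurable
matrix kernel `k`; the integral converges absolutely for almost every `x`. -/
def HasKernel {m : ℕ} {r : ℝ} (K : L2Vec m r →L[ℂ] L2Vec m r)
    (k : ℝ → ℝ → Matrix (Fin m) (Fin m) ℂ) : Prop :=
  (∀ i j, AEStronglyMeasurable (fun p : ℝ × ℝ => k p.1 p.2 i j)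
    ((intervalMeasure r).prod (intervalMeasure r))) ∧
  ∀ f : L2Vec m r, ∀ᵐ x ∂(intervalMeasure r),
    Integrable (fun t => Matrix.toEuclideanLin (k x t) (f t)) (intervalMeasure r) ∧
    K f x = ∫ t, Matrix.toEuclideanLin (k x t) (f t) ∂(intervalMeasure r)

/-- The entrywise partial derivative `∂U/∂t (x, t)` of a matrix function of two variables. -/
noncomputable def partialT {m : ℕ} (U : ℝ → ℝ → Matrix (Fin m) (Fin m) ℂ) (x t : ℝ) :
    Matrix (Fin m) (Fin m) ℂ :=
  Matrix.of fun i j => deriv (fun τ => U x τ i j) t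

/-- `T = d/dx ∫₀ʳ s(x,t) · dt`: for every `f`, the function `g(x) = ∫₀ʳ s(x,t) f(t) dt` is
absolutely continuous on `[0, r]` and `g' = T f` almost everywhere. -/
def IsDerivOfIntegral {m : ℕ} {r : ℝ} (T : L2Vec m r →L[ℂ] L2Vec m r)
    (s : ℝ → ℝ → Matrix (Fin m) (Fin m) ℂ) : Prop :=
  ∀ f : L2Vec m r,
    AbsolutelyContinuousOnInterval
      (fun x => ∫ t, Matrix.toEuclideanLin (s x t) (f t) ∂(intervalMeasure r)) 0 r ∧
    ∀ᵐ x ∂(intervalMeasure r),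
      HasDerivAt (fun y => ∫ t, Matrix.toEuclideanLin (s y t) (f t) ∂(intervalMeasure r))
        (T f x) x

/-- The `(i, j)` entry of `s ↦ Z((x+t+s)/2, (x+t-s)/2)`, the kernel along the line on which the
sum of the two variables is `x + t`. -/
noncomputable def antidiagEntry {m : ℕ} (Z : ℝ → ℝ → Matrix (Fin m) (Fin m) ℂ) (x t : ℝ)
    (i j : Fin m) (s : ℝ) : ℂ :=
  Z ((x + t + s) / 2) ((x + t - s) / 2) i j

/-- `υ(x+t) + (i/2) ∫_{-min(x+t, 2r-x-t)}^{x-t} Z((x+t+s)/2, (x+t-s)/2) ds`. -/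
noncomputable def upsilonFormula {m : ℕ} (r : ℝ) (Z : ℝ → ℝ → Matrix (Fin m) (Fin m) ℂ)
    (υ : ℝ → Matrix (Fin m) (Fin m) ℂ) (x t : ℝ) : Matrix (Fin m) (Fin m) ℂ :=
  Matrix.of fun i j => υ (x + t) i j +
    Complex.I / 2 * ∫ s in (-min (x + t) (2 * r - x - t))..(x - t), antidiagEntry Z x t i j s

/-- The kernel is bounded on the closed square `[0, r]²` and continuous there off the diagonal
(in particular, every continuous kernel qualifies). -/
def IsRegularKernel {m : ℕ} (r : ℝ) (Z : ℝ → ℝ → Matrix (Fin m) (Fin m) ℂ) : Prop :=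
  (∃ C : ℝ, ∀ x ∈ Icc 0 r, ∀ t ∈ Icc 0 r, ∀ i j, ‖Z x t i j‖ ≤ C) ∧
  ∀ i j, ContinuousOn (fun p : ℝ × ℝ => Z p.1 p.2 i j)
    {p | p.1 ∈ Icc 0 r ∧ p.2 ∈ Icc 0 r ∧ p.1 ≠ p.2}

theorem AbsolutelyContinuousOnInterval.of_dist_le {X Y : Type*} [PseudoMetricSpace X]
    [PseudoMetricSpace Y] {f : ℝ → X} {g : ℝ → Y} {a b : ℝ}
    (hg : AbsolutelyContinuousOnInterval g a b)
    (h : ∀ x ∈ uIcc a b, ∀ y ∈ uIcc a b, dist (f x) (f y) ≤ dist (g x) (g y)) :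
    AbsolutelyContinuousOnInterval f a b := by
  rw [absolutelyContinuousOnInterval_iff] at hg ⊢
  intro ε hε
  obtain ⟨δ, hδ, H⟩ := hg ε hε
  refine ⟨δ, hδ, fun E hE hlt => lt_of_le_of_lt (Finset.sum_le_sum fun i hi => ?_) (H E hE hlt)⟩
  exact h _ (hE.1 i hi).1 _ (hE.1 i hi).2

section Tail

variable {E : Type*} [NormedAddCommGroup E] [NormedSpace ℝ E] {G : ℝ → E}

theorem integral_Ioi_eq_sub_intervalIntegral (hG : Integrable G) (a t : ℝ) :
    ∫ u in Ioi t, G u = (∫ u in Ioi a, G u) - ∫ u in a..t, G u := by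
  rw [← intervalIntegral.integral_Ioi_sub_Ioi' hG.integrableOn hG.integrableOn]; abel

theorem absolutelyContinuousOnInterval_integral_Ioi (hG : Integrable G) (a b : ℝ) :
    AbsolutelyContinuousOnInterval (fun t => ∫ u in Ioi t, G u) a b := by
  have h := (hG.norm.intervalIntegrable (a := a) (b := b)
    ).absolutelyContinuousOnInterval_intervalIntegral left_mem_uIcc
  refine h.of_dist_le fun x _ y _ => ?_
  simp only [dist_eq_norm]
  rw [integral_Ioi_eq_sub_intervalIntegral hG a x, integral_Ioi_eq_sub_intervalIntegral hG a y,
    sub_sub_sub_cancel_left, norm_sub_rev,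
    intervalIntegral.integral_interval_sub_left hG.intervalIntegrable hG.intervalIntegrable,
    intervalIntegral.integral_interval_sub_left hG.norm.intervalIntegrable
      hG.norm.intervalIntegrable, Real.norm_eq_abs]
  exact intervalIntegral.norm_integral_le_abs_integral_norm

theorem ae_hasDerivAt_integral_Ioi [CompleteSpace E] (hG : Integrable G) :
    ∀ᵐ t, HasDerivAt (fun t => ∫ u in Ioi t, G u) (-G t) t := by
  filter_upwards [LocallyIntegrable.ae_hasDerivAt_integral hG.locallyIntegrable] with t ht
  have := (ht 0).const_sub (∫ u in Ioi 0, G u)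
  refine this.congr_of_eventuallyEq (Filter.Eventually.of_forall fun s => ?_)
  exact integral_Ioi_eq_sub_intervalIntegral hG 0 s

theorem continuous_integral_Ioi (hG : Integrable G) : Continuous fun t => ∫ u in Ioi t, G u := by
  have : (fun t => ∫ u in Ioi t, G u) = fun t => (∫ u in Ioi 0, G u) - ∫ u in 0..t, G u := by
    funext t; exact integral_Ioi_eq_sub_intervalIntegral hG 0 t
  rw [this]
  exact continuous_const.sub (intervalIntegral.continuous_primitive
    (fun _ _ => hG.intervalIntegrable) 0)

end Tail

theorem integrable_indicator_of_intervalMeasure {E : Type*} [NormedAddCommGroup E] {F : ℝ → E}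
    {r : ℝ} (hF : Integrable F (intervalMeasure r)) : Integrable ((Ioo 0 r).indicator F) :=
  (integrable_indicator_iff measurableSet_Ioo).2 hF

section IntervalMeasure

variable {E : Type*} [NormedAddCommGroup E] [NormedSpace ℝ E] {F : ℝ → E} {r : ℝ}

theorem setIntegral_intervalMeasure (s : Set ℝ) (hs : MeasurableSet s) :
    ∫ u in s, F u ∂(intervalMeasure r) = ∫ u in s, (Ioo 0 r).indicator F u := by
  rw [setIntegral_indicator measurableSet_Ioo, Measure.restrict_restrict hs]

theorem integral_Ioi_intervalMeasure {x : ℝ} (hx : x ∈ Icc 0 r) :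
    ∫ u in Ioi x, F u ∂(intervalMeasure r) = ∫ u in x..r, F u := by
  rw [intervalIntegral.integral_of_le hx.2, Measure.restrict_restrict measurableSet_Ioi,
    integral_Ioc_eq_integral_Ioo]
  congr 2
  ext u
  simp only [mem_inter_iff, mem_Ioi, mem_Ioo]
  constructor
  · rintro ⟨h1, h2, h3⟩; exact ⟨h1, h3⟩
  · rintro ⟨h1, h3⟩; exact ⟨h1, hx.1.trans_lt h1, h3⟩

theorem setIntegral_Ioi_clamp (t : ℝ) :
    ∫ u in Ioi t, F u ∂(intervalMeasure r) =
      ∫ u in Ioi (max 0 (min t r)), F u ∂(intervalMeasure r) := by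
  rw [Measure.restrict_restrict measurableSet_Ioi, Measure.restrict_restrict measurableSet_Ioi]
  congr 2
  ext u
  simp only [mem_inter_iff, mem_Ioi, mem_Ioo, max_lt_iff, min_lt_iff]
  constructor
  · rintro ⟨h1, h2, h3⟩; exact ⟨⟨h2, Or.inl h1⟩, h2, h3⟩
  · rintro ⟨⟨-, h | h⟩, h2, h3⟩
    · exact ⟨h, h2, h3⟩
    · exact absurd h3 h.not_gt

theorem continuous_integral_Ioi_intervalMeasure (hF : Integrable F (intervalMeasure r)) :
    Continuous fun t => ∫ u in Ioi t, F u ∂(intervalMeasure r) := by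
  simp only [setIntegral_intervalMeasure _ measurableSet_Ioi]
  exact continuous_integral_Ioi (integrable_indicator_of_intervalMeasure hF)

theorem ae_hasDerivAt_integral_Ioi_intervalMeasure [CompleteSpace E]
    (hF : Integrable F (intervalMeasure r)) :
    ∀ᵐ t ∂(intervalMeasure r),
      HasDerivAt (fun t => ∫ u in Ioi t, F u ∂(intervalMeasure r)) (-F t) t := by
  simp only [setIntegral_intervalMeasure _ measurableSet_Ioi]
  filter_upwards [ae_restrict_of_ae (ae_hasDerivAt_integral_Ioi
    (integrable_indicator_of_intervalMeasure hF)), ae_restrict_mem measurableSet_Ioo] with t ht htr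
  rwa [indicator_of_mem htr] at ht

theorem absolutelyContinuousOnInterval_integral_Ioi_intervalMeasure
    (hF : Integrable F (intervalMeasure r)) (a b : ℝ) :
    AbsolutelyContinuousOnInterval (fun t => ∫ u in Ioi t, F u ∂(intervalMeasure r)) a b := by
  simp only [setIntegral_intervalMeasure _ measurableSet_Ioi]
  exact absolutelyContinuousOnInterval_integral_Ioi (integrable_indicator_of_intervalMeasure hF) a b

theorem ae_eq_of_integral_Ioi_eq [CompleteSpace E] {F' : ℝ → E}
    (hF : Integrable F (intervalMeasure r)) (hF' : Integrable F' (intervalMeasure r))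
    (h : ∀ x ∈ Icc 0 r, ∫ u in Ioi x, F u ∂(intervalMeasure r) =
      ∫ u in Ioi x, F' u ∂(intervalMeasure r)) : F =ᵐ[intervalMeasure r] F' := by
  have h' : ∀ x, ∫ u in Ioi x, F u ∂(intervalMeasure r) =
      ∫ u in Ioi x, F' u ∂(intervalMeasure r) := by
    intro x
    rcases le_or_gt 0 r with hr | hr
    · rw [setIntegral_Ioi_clamp x, setIntegral_Ioi_clamp (F := F') x]
      exact h _ ⟨le_max_left _ _, max_le hr (min_le_right _ _)⟩
    · simp [intervalMeasure, Ioo_eq_empty_of_le hr.le]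
  filter_upwards [ae_hasDerivAt_integral_Ioi_intervalMeasure hF,
    ae_hasDerivAt_integral_Ioi_intervalMeasure hF'] with t h1 h2
  simp only [h'] at h1
  exact neg_injective (h1.unique h2)

end IntervalMeasure

section Step

variable {m : ℕ} {r : ℝ}

/-- The element `1_{(t, r)} e_j` of `L₂^m(0, r)`. -/
noncomputable def stepVec (r : ℝ) (j : Fin m) (t : ℝ) : L2Vec m r :=
  indicatorConstLp 2 (measurableSet_Ioi (a := t)) (measure_ne_top _ _)
    (EuclideanSpace.single j (1 : ℂ))

theorem stepVec_coeFn (j : Fin m) (t : ℝ) :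
    stepVec r j t =ᵐ[intervalMeasure r]
      (Ioi t).indicator fun _ => EuclideanSpace.single j (1 : ℂ) :=
  indicatorConstLp_coeFn

theorem stepVec_of_le (j : Fin m) {t : ℝ} (ht : r ≤ t) : stepVec r j t = 0 := by
  rw [Lp.eq_zero_iff_ae_eq_zero]
  filter_upwards [stepVec_coeFn j t, ae_restrict_mem measurableSet_Ioo] with x hx hxr
  rw [hx, indicator_of_notMem (by simp only [mem_Ioi, not_lt]; exact hxr.2.le.trans ht)]
  rfl

theorem continuous_stepVec (r : ℝ) (j : Fin m) : Continuous (stepVec r j) := by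
  refine continuous_indicatorConstLp_set (by norm_num) fun x => ?_
  have h0 : Filter.Tendsto (fun y : ℝ => ENNReal.ofReal |x - y|) (nhds x) (nhds 0) := by
    have : Continuous fun y : ℝ => ENNReal.ofReal |x - y| :=
      ENNReal.continuous_ofReal.comp (by fun_prop)
    simpa using this.tendsto x
  refine tendsto_of_tendsto_of_tendsto_of_le_of_le tendsto_const_nhds h0 (fun _ => zero_le)
    fun y => ?_
  have hsub : symmDiff (Ioi y) (Ioi x) ⊆ uIoc y x := by
    intro z hz
    rw [mem_symmDiff] at hz
    rw [mem_uIoc]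
    simpa [mem_Ioi, not_lt] using hz
  calc intervalMeasure r (symmDiff (Ioi y) (Ioi x)) ≤ intervalMeasure r (uIoc y x) :=
        measure_mono hsub
    _ ≤ volume (uIoc y x) := Measure.restrict_apply_le _ _
    _ = _ := by simp

theorem norm_stepVec_le (r : ℝ) (j : Fin m) (t : ℝ) :
    ‖stepVec r j t‖ ≤ (intervalMeasure r).real univ ^ (1 / 2 : ℝ) := by
  rw [stepVec, norm_indicatorConstLp (by norm_num) (by norm_num)]
  simp only [PiLp.norm_single, norm_one, one_mul, ENNReal.toReal_ofNat]
  exact Real.rpow_le_rpow measureReal_nonneg (measureReal_mono (subset_univ _)) (by norm_num)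

theorem L2Vec.integrable_apply (F : L2Vec m r) (i : Fin m) :
    Integrable (fun u => F u i) (intervalMeasure r) :=
  ((EuclideanSpace.proj i : EuclideanSpace ℂ (Fin m) →L[ℂ] ℂ).integrable_comp F.integrable :)

theorem L2Vec.memLp_apply (F : L2Vec m r) (i : Fin m) :
    MemLp (fun u => F u i) 2 (intervalMeasure r) :=
  ((EuclideanSpace.proj i : EuclideanSpace ℂ (Fin m) →L[ℂ] ℂ).comp_memLp F :)

theorem inner_stepVec (i : Fin m) (x : ℝ) (F : L2Vec m r) :
    inner ℂ (stepVec r i x) F = ∫ u in Ioi x, F u i ∂(intervalMeasure r) := by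
  rw [stepVec, L2.inner_indicatorConstLp_eq_setIntegral_inner]
  simp [EuclideanSpace.inner_single_left]

theorem inner_stepVec_right (i : Fin m) (x : ℝ) (F : L2Vec m r) :
    inner ℂ F (stepVec r i x) =
      ∫ u in Ioi x, starRingEnd ℂ (F u i) ∂(intervalMeasure r) := by
  rw [← inner_conj_symm, inner_stepVec, integral_conj]

theorem volterraOp_stepVec (j : Fin m) {x : ℝ} (hx : x ∈ Icc 0 r) :
    volterraOp m r (stepVec r j x) =ᵐ[intervalMeasure r] fun u =>
      (Complex.I * (max (u - x) 0 : ℝ)) • EuclideanSpace.single j (1 : ℂ) := by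
  filter_upwards [volterraOp_ae_eq (stepVec r j x), ae_restrict_mem measurableSet_Ioo] with u hu hur
  have hs : ∀ᵐ t ∂(volume.restrict (Ioc 0 u)), stepVec r j x t =
      (Ioi x).indicator (fun _ => EuclideanSpace.single j (1 : ℂ)) t :=
    ae_restrict_of_ae_restrict_of_subset (s := Ioc 0 u) (t := Ioo 0 r)
      (fun _ ht => ⟨ht.1, lt_of_le_of_lt ht.2 hur.2⟩) (stepVec_coeFn j x)
  rw [hu, intervalIntegral.integral_of_le hur.1.le, integral_congr_ae hs,
    setIntegral_indicator measurableSet_Ioi, setIntegral_const, Ioc_inter_Ioi, max_eq_right hx.1,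
    measureReal_def, Real.volume_Ioc, ENNReal.toReal_ofReal', mul_smul, Complex.coe_smul]

theorem inner_volterraOp_stepVec (i : Fin m) {x : ℝ} (hx : x ∈ Icc 0 r) (F : L2Vec m r) :
    inner ℂ (volterraOp m r (stepVec r i x)) F =
      -Complex.I * ∫ s in x..r, inner ℂ (stepVec r i s) F := by
  have h1 : inner ℂ (volterraOp m r (stepVec r i x)) F =
      ∫ u, -Complex.I * ((max (u - x) 0 : ℝ) * F u i) ∂(intervalMeasure r) := by
    rw [L2.inner_def]
    refine integral_congr_ae ?_
    filter_upwards [volterraOp_stepVec i hx] with u hu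
    rw [hu, inner_smul_left, EuclideanSpace.inner_single_left]
    simp [mul_assoc]
  have hint : Integrable (Function.uncurry fun s u : ℝ => (Ioi s).indicator (fun v => F v i) u)
      ((volume.restrict (Ioc x r)).prod (intervalMeasure r)) := by
    have h2 := ((F.integrable_apply i).comp_snd (volume.restrict (Ioc x r))).indicator
      (s := {p : ℝ × ℝ | p.1 < p.2}) (measurableSet_lt measurable_fst measurable_snd)
    refine h2.congr (Filter.Eventually.of_forall fun p => ?_)
    simp [indicator, Function.uncurry]
  have h3 : ∫ s in x..r, inner ℂ (stepVec r i s) F =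
      ∫ u, ((max (u - x) 0 : ℝ) * F u i) ∂(intervalMeasure r) := by
    simp only [inner_stepVec, ← integral_indicator measurableSet_Ioi]
    rw [intervalIntegral.integral_of_le hx.2, integral_integral_swap hint]
    refine integral_congr_ae ?_
    filter_upwards [ae_restrict_mem measurableSet_Ioo] with u hu
    have h4 : (fun s => (Ioi s).indicator (fun v => F v i) u) =
        (Iio u).indicator fun _ => F u i := by
      funext s; simp [indicator]
    rw [h4, setIntegral_indicator measurableSet_Iio, setIntegral_const]
    have h5 : Ioc x r ∩ Iio u = Ioo x u := by
      ext s
      simp only [mem_inter_iff, mem_Ioc, mem_Iio, mem_Ioo]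
      exact ⟨fun h => ⟨h.1.1, h.2⟩, fun h => ⟨⟨h.1, (h.2.trans hu.2).le⟩, h.2⟩⟩
    rw [h5, measureReal_def, Real.volume_Ioo, ENNReal.toReal_ofReal', Complex.real_smul]
  rw [h1, h3, integral_const_mul]

end Step

section Corner

variable {m : ℕ} {r : ℝ}

/-- The matrix entry of `T` between `1_{(x, r)} e_i` and `1_{(t, r)} e_j`. -/
noncomputable def cornerFun (T : L2Vec m r →L[ℂ] L2Vec m r) (i j : Fin m) (x t : ℝ) : ℂ :=
  inner ℂ (stepVec r i x) (T (stepVec r j t))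

variable (T : L2Vec m r →L[ℂ] L2Vec m r) (i j : Fin m)

theorem continuous_cornerFun : Continuous fun p : ℝ × ℝ => cornerFun T i j p.1 p.2 :=
  ((continuous_stepVec r i).comp continuous_fst).inner
    (T.continuous.comp ((continuous_stepVec r j).comp continuous_snd))

theorem cornerFun_of_le_left {x : ℝ} (hx : r ≤ x) (t : ℝ) : cornerFun T i j x t = 0 := by
  rw [cornerFun, stepVec_of_le i hx, inner_zero_left]

theorem cornerFun_of_le_right (x : ℝ) {t : ℝ} (ht : r ≤ t) : cornerFun T i j x t = 0 := by
  rw [cornerFun, stepVec_of_le j ht, map_zero, inner_zero_right]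

theorem cornerFun_eq_integral_left (x t : ℝ) :
    cornerFun T i j x t = ∫ u in Ioi x, T (stepVec r j t) u i ∂(intervalMeasure r) :=
  inner_stepVec i x _

/-- The `(i, j)` entry of the kernel of `f ↦ ∫ₓʳ T f`. -/
noncomputable def rowFun (x u : ℝ) : ℂ :=
  starRingEnd ℂ (ContinuousLinearMap.adjoint T (stepVec r i x) u j)

theorem cornerFun_eq_integral_right (x t : ℝ) :
    cornerFun T i j x t = ∫ u in Ioi t, rowFun T i j x u ∂(intervalMeasure r) := by
  rw [cornerFun, ← ContinuousLinearMap.adjoint_inner_left, inner_stepVec_right]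
  rfl

theorem memLp_rowFun (x : ℝ) : MemLp (rowFun T i j x) 2 (intervalMeasure r) :=
  (((ContinuousLinearMap.adjoint T (stepVec r i x)).memLp_apply j).star :)

theorem integrable_rowFun (x : ℝ) : Integrable (rowFun T i j x) (intervalMeasure r) :=
  (memLp_rowFun T i j x).integrable (by norm_num)

theorem ae_deriv_cornerFun_right (x : ℝ) :
    (fun t => deriv (cornerFun T i j x) t) =ᵐ[intervalMeasure r] fun t => -rowFun T i j x t := by
  filter_upwards [ae_hasDerivAt_integral_Ioi_intervalMeasure (integrable_rowFun T i j x)] with t ht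
  rw [show cornerFun T i j x = _ from funext (cornerFun_eq_integral_right T i j x)]
  exact ht.deriv

theorem ae_deriv_cornerFun_left (t : ℝ) :
    (fun x => deriv (fun y => cornerFun T i j y t) x) =ᵐ[intervalMeasure r]
      fun x => -T (stepVec r j t) x i := by
  filter_upwards [ae_hasDerivAt_integral_Ioi_intervalMeasure
    ((T (stepVec r j t)).integrable_apply i)] with x hx
  rw [show (fun y => cornerFun T i j y t) = _ from
    funext fun x => cornerFun_eq_integral_left T i j x t]
  exact hx.deriv

theorem integral_norm_apply_stepVec_le (S : L2Vec m r →L[ℂ] L2Vec m r) (x : ℝ) :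
    ∫ u, ‖S (stepVec r i x) u j‖ ∂(intervalMeasure r) ≤
      ‖S‖ * (intervalMeasure r).real univ ^ (1 / 2 : ℝ) *
        (intervalMeasure r univ ^ (1 / 2 : ℝ)).toReal := by
  calc ∫ u, ‖S (stepVec r i x) u j‖ ∂(intervalMeasure r)
      ≤ ∫ u, ‖S (stepVec r i x) u‖ ∂(intervalMeasure r) :=
        integral_mono ((S (stepVec r i x)).integrable_apply j).norm
          (S (stepVec r i x)).integrable.norm fun u => PiLp.norm_apply_le _ j
    _ ≤ ‖S (stepVec r i x)‖ * (intervalMeasure r univ ^ (1 / 2 : ℝ)).toReal :=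
        L2Vec.integral_norm_le _
    _ ≤ _ := by
        gcongr
        exact (S.le_opNorm _).trans (by gcongr; exact norm_stepVec_le r i x)

theorem integrable_deriv_cornerFun_right :
    Integrable (fun p : ℝ × ℝ => deriv (cornerFun T i j p.1) p.2)
      ((intervalMeasure r).prod (intervalMeasure r)) := by
  have hm : StronglyMeasurable fun p : ℝ × ℝ => deriv (cornerFun T i j p.1) p.2 :=
    stronglyMeasurable_deriv_with_param (continuous_cornerFun T i j)
  rw [integrable_prod_iff hm.aestronglyMeasurable]
  refine ⟨Filter.Eventually.of_forall fun x =>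
    (integrable_rowFun T i j x).neg.congr (ae_deriv_cornerFun_right T i j x).symm, ?_⟩
  refine Integrable.of_bound hm.norm.integral_prod_right'.aestronglyMeasurable
    (‖ContinuousLinearMap.adjoint T‖ * (intervalMeasure r).real univ ^ (1 / 2 : ℝ) *
        (intervalMeasure r univ ^ (1 / 2 : ℝ)).toReal)
    (Filter.Eventually.of_forall fun x => ?_)
  rw [Real.norm_of_nonneg (integral_nonneg fun _ => norm_nonneg _)]
  refine le_trans (le_of_eq ?_)
    (integral_norm_apply_stepVec_le i j (ContinuousLinearMap.adjoint T) x)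
  refine integral_congr_ae ?_
  filter_upwards [ae_deriv_cornerFun_right T i j x] with t ht
  rw [ht, norm_neg, rowFun, RCLike.norm_conj]

theorem integrable_deriv_cornerFun_left :
    Integrable (fun p : ℝ × ℝ => deriv (fun y => cornerFun T i j y p.2) p.1)
      ((intervalMeasure r).prod (intervalMeasure r)) := by
  have hc : Continuous (Function.uncurry fun t y => cornerFun T i j y t) := by
    have h := (continuous_cornerFun T i j).comp (continuous_swap (X := ℝ) (Y := ℝ))
    simpa only [Function.comp_def, Function.uncurry_def, Prod.fst_swap, Prod.snd_swap] using h
  have hm : StronglyMeasurable fun p : ℝ × ℝ => deriv (fun y => cornerFun T i j y p.1) p.2 :=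
    stronglyMeasurable_deriv_with_param hc
  refine Integrable.swap (f := fun p : ℝ × ℝ => deriv (fun y => cornerFun T i j y p.1) p.2) ?_
  rw [integrable_prod_iff hm.aestronglyMeasurable]
  refine ⟨Filter.Eventually.of_forall fun t =>
    ((T (stepVec r j t)).integrable_apply i).neg.congr (ae_deriv_cornerFun_left T i j t).symm, ?_⟩
  refine Integrable.of_bound hm.norm.integral_prod_right'.aestronglyMeasurable
    (‖T‖ * (intervalMeasure r).real univ ^ (1 / 2 : ℝ) *
        (intervalMeasure r univ ^ (1 / 2 : ℝ)).toReal)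
    (Filter.Eventually.of_forall fun t => ?_)
  rw [Real.norm_of_nonneg (integral_nonneg fun _ => norm_nonneg _)]
  refine le_trans (le_of_eq ?_) (integral_norm_apply_stepVec_le j i T t)
  refine integral_congr_ae ?_
  filter_upwards [ae_deriv_cornerFun_left T i j t] with x hx
  rw [hx, norm_neg]

/-- `i (∂ₜ - ∂ₓ)` applied to the corner function. -/
noncomputable def cornerKernel (x t : ℝ) : ℂ :=
  Complex.I * (deriv (cornerFun T i j x) t - deriv (fun y => cornerFun T i j y t) x)

theorem integrable_cornerKernel :
    Integrable (fun p : ℝ × ℝ => cornerKernel T i j p.1 p.2)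
      ((intervalMeasure r).prod (intervalMeasure r)) :=
  ((integrable_deriv_cornerFun_right T i j).sub (integrable_deriv_cornerFun_left T i j)).const_mul _

theorem integral_integral_cornerKernel {x t : ℝ} (hx : x ∈ Icc 0 r) (ht : t ∈ Icc 0 r) :
    ∫ y in Ioi x, ∫ u in Ioi t, cornerKernel T i j y u ∂(intervalMeasure r) ∂(intervalMeasure r) =
      Complex.I * (∫ u in t..r, cornerFun T i j x u) -
        Complex.I * ∫ y in x..r, cornerFun T i j y t := by
  have hle : ((intervalMeasure r).restrict (Ioi x)).prod ((intervalMeasure r).restrict (Ioi t)) ≤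
      (intervalMeasure r).prod (intervalMeasure r) := by
    rw [Measure.prod_restrict]; exact Measure.restrict_le_self
  have h1 := (integrable_deriv_cornerFun_right T i j).mono_measure hle
  have h2 := (integrable_deriv_cornerFun_left T i j).mono_measure hle
  have e1 : ∫ y in Ioi x, ∫ u in Ioi t, deriv (cornerFun T i j y) u ∂(intervalMeasure r)
      ∂(intervalMeasure r) = -∫ y in x..r, cornerFun T i j y t := by
    rw [← integral_Ioi_intervalMeasure hx, ← integral_neg]
    congr 1; funext y
    rw [cornerFun_eq_integral_right, ← integral_neg]
    exact integral_congr_ae (ae_restrict_of_ae (ae_deriv_cornerFun_right T i j y))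
  have e2 : ∫ y in Ioi x, ∫ u in Ioi t, deriv (fun z => cornerFun T i j z u) y ∂(intervalMeasure r)
      ∂(intervalMeasure r) = -∫ u in t..r, cornerFun T i j x u := by
    rw [integral_integral_swap h2, ← integral_Ioi_intervalMeasure ht, ← integral_neg]
    congr 1; funext u
    rw [cornerFun_eq_integral_left, ← integral_neg]
    exact integral_congr_ae (ae_restrict_of_ae (ae_deriv_cornerFun_left T i j u))
  have e3 : ∫ y in Ioi x, ∫ u in Ioi t, cornerKernel T i j y u
      ∂(intervalMeasure r) ∂(intervalMeasure r) =
      Complex.I * ((∫ y in Ioi x, ∫ u in Ioi t, deriv (cornerFun T i j y) u ∂(intervalMeasure r)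
      ∂(intervalMeasure r)) - ∫ y in Ioi x, ∫ u in Ioi t, deriv (fun z => cornerFun T i j z u) y
      ∂(intervalMeasure r) ∂(intervalMeasure r)) := by
    rw [integral_integral (f := cornerKernel T i j) ((h1.sub h2).const_mul _),
      integral_integral h1, integral_integral h2, ← integral_sub h1 h2, ← integral_const_mul]
    rfl
  rw [e3, e1, e2]; ring

theorem inner_stepVec_volterra_identity {Zop : L2Vec m r →L[ℂ] L2Vec m r}
    (hT : T ∘L volterraOp m r + ContinuousLinearMap.adjoint (volterraOp m r) ∘L T = Zop)
    {x t : ℝ} (hx : x ∈ Icc 0 r) (ht : t ∈ Icc 0 r) :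
    ∫ y in Ioi x, Zop (stepVec r j t) y i ∂(intervalMeasure r) =
      Complex.I * (∫ u in t..r, cornerFun T i j x u) -
        Complex.I * ∫ y in x..r, cornerFun T i j y t := by
  rw [← inner_stepVec, ← hT, add_apply, inner_add_right,
    ContinuousLinearMap.comp_apply, ContinuousLinearMap.comp_apply,
    ContinuousLinearMap.adjoint_inner_right, inner_volterraOp_stepVec i hx,
    ← ContinuousLinearMap.adjoint_inner_left, ← inner_conj_symm, inner_volterraOp_stepVec j ht,
    map_mul, intervalIntegral.integral_of_le ht.2, ← integral_conj,
    ← intervalIntegral.integral_of_le ht.2]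
  simp only [inner_conj_symm, ContinuousLinearMap.adjoint_inner_left, map_neg, Complex.conj_I,
    neg_neg]
  simp only [cornerFun]
  ring

end Corner

section Kernel

variable {m : ℕ} {r : ℝ} {Zop : L2Vec m r →L[ℂ] L2Vec m r}
  {Z : ℝ → ℝ → Matrix (Fin m) (Fin m) ℂ}

theorem toEuclideanLin_stepVec_ae (A : ℝ → Matrix (Fin m) (Fin m) ℂ) (i j : Fin m) (t : ℝ) :
    (fun u => Matrix.toEuclideanLin (A u) (stepVec r j t u) i) =ᵐ[intervalMeasure r]
      (Ioi t).indicator fun u => A u i j := by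
  filter_upwards [stepVec_coeFn j t] with u hu
  rw [hu]
  by_cases h : u ∈ Ioi t
  · simp [h, Matrix.toLpLin_apply]
  · simp [h]

theorem HasKernel.ae_stepVec (hZ : HasKernel Zop Z) (i j : Fin m) (t : ℝ) :
    ∀ᵐ y ∂(intervalMeasure r),
      IntegrableOn (fun u => Z y u i j) (Ioi t) (intervalMeasure r) ∧
      Zop (stepVec r j t) y i = ∫ u in Ioi t, Z y u i j ∂(intervalMeasure r) := by
  filter_upwards [hZ.2 (stepVec r j t)] with y hy
  have h1 := (EuclideanSpace.proj i : EuclideanSpace ℂ (Fin m) →L[ℂ] ℂ).integrable_comp hy.1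
  have h2 := toEuclideanLin_stepVec_ae (r := r) (Z y) i j t
  refine ⟨(integrable_indicator_iff measurableSet_Ioi).1 (h1.congr h2), ?_⟩
  rw [← integral_indicator measurableSet_Ioi, ← integral_congr_ae h2, hy.2]
  exact ((EuclideanSpace.proj i : EuclideanSpace ℂ (Fin m) →L[ℂ] ℂ).integral_comp_comm hy.1).symm

theorem HasKernel.ae_integrable (hZ : HasKernel Zop Z) (i j : Fin m) :
    ∀ᵐ y ∂(intervalMeasure r), Integrable (fun u => Z y u i j) (intervalMeasure r) := by
  filter_upwards [hZ.ae_stepVec i j 0] with y hy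
  have h : (intervalMeasure r).restrict (Ioi 0) = intervalMeasure r := by
    rw [Measure.restrict_restrict measurableSet_Ioi,
      inter_eq_self_of_subset_right fun u hu => hu.1]
  have h1 := hy.1
  rwa [IntegrableOn, h] at h1

variable {T : L2Vec m r →L[ℂ] L2Vec m r}

theorem HasKernel.ae_eq_cornerKernel (hr : 0 < r) (hZ : HasKernel Zop Z)
    (hT : T ∘L volterraOp m r + ContinuousLinearMap.adjoint (volterraOp m r) ∘L T = Zop)
    (i j : Fin m) :
    ∀ᵐ y ∂(intervalMeasure r),
      (fun u => Z y u i j) =ᵐ[intervalMeasure r] cornerKernel T i j y := by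
  have hK := integrable_cornerKernel T i j
  have key : ∀ t : ℝ, ∀ᵐ y ∂(intervalMeasure r),
      ∫ u in Ioi t, Z y u i j ∂(intervalMeasure r) =
        ∫ u in Ioi t, cornerKernel T i j y u ∂(intervalMeasure r) := by
    intro t
    have ht : max 0 (min t r) ∈ Icc 0 r := ⟨le_max_left _ _, max_le hr.le (min_le_right _ _)⟩
    have hint : Integrable (fun y => ∫ u in Ioi (max 0 (min t r)), cornerKernel T i j y u
        ∂(intervalMeasure r)) (intervalMeasure r) := by
      have h1 : Integrable (fun p : ℝ × ℝ => cornerKernel T i j p.1 p.2)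
          ((intervalMeasure r).prod ((intervalMeasure r).restrict (Ioi (max 0 (min t r))))) :=
        hK.mono_measure (Measure.prod_mono le_rfl Measure.restrict_le_self)
      exact h1.integral_prod_left
    have h2 : (fun y => Zop (stepVec r j (max 0 (min t r))) y i) =ᵐ[intervalMeasure r]
        fun y => ∫ u in Ioi (max 0 (min t r)), cornerKernel T i j y u ∂(intervalMeasure r) :=
      ae_eq_of_integral_Ioi_eq (L2Vec.integrable_apply _ i) hint fun x hx => by
        rw [integral_integral_cornerKernel T i j hx ht, inner_stepVec_volterra_identity T i j hT hx ht]
    filter_upwards [h2, hZ.ae_stepVec i j (max 0 (min t r))] with y h3 h4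
    rw [setIntegral_Ioi_clamp t, setIntegral_Ioi_clamp (F := cornerKernel T i j y) t, ← h4.2, h3]
  have hq : ∀ᵐ y ∂(intervalMeasure r), ∀ q : ℚ,
      ∫ u in Ioi (q : ℝ), Z y u i j ∂(intervalMeasure r) =
        ∫ u in Ioi (q : ℝ), cornerKernel T i j y u ∂(intervalMeasure r) :=
    ae_all_iff.2 fun q => key q
  filter_upwards [hq, hZ.ae_integrable i j, hK.prod_right_ae] with y h1 h2 h3
  refine ae_eq_of_integral_Ioi_eq h2 h3 fun x _ => ?_
  have h4 := Rat.denseRange_cast (𝕜 := ℝ)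
  exact congrFun (h4.equalizer (continuous_integral_Ioi_intervalMeasure h2)
    (continuous_integral_Ioi_intervalMeasure h3) (funext h1)) x

theorem HasKernel.integrable_prod (hr : 0 < r) (hZ : HasKernel Zop Z)
    (hT : T ∘L volterraOp m r + ContinuousLinearMap.adjoint (volterraOp m r) ∘L T = Zop)
    (i j : Fin m) :
    Integrable (fun p : ℝ × ℝ => Z p.1 p.2 i j)
      ((intervalMeasure r).prod (intervalMeasure r)) := by
  rw [integrable_prod_iff (hZ.1 i j)]
  refine ⟨hZ.ae_integrable i j, (integrable_cornerKernel T i j).integral_norm_prod_left.congr ?_⟩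
  filter_upwards [hZ.ae_eq_cornerKernel hr hT i j] with y hy
  refine integral_congr_ae ?_
  filter_upwards [hy] with u hu
  rw [hu]

/-- The `(i, j)` entry of the kernel, extended by zero outside the open square. -/
noncomputable def extKernel (r : ℝ) (Z : ℝ → ℝ → Matrix (Fin m) (Fin m) ℂ) (i j : Fin m)
    (y u : ℝ) : ℂ :=
  (Ioo 0 r ×ˢ Ioo 0 r).indicator (fun p : ℝ × ℝ => Z p.1 p.2 i j) (y, u)

theorem HasKernel.integrable_extKernel (hr : 0 < r) (hZ : HasKernel Zop Z)
    (hT : T ∘L volterraOp m r + ContinuousLinearMap.adjoint (volterraOp m r) ∘L T = Zop)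
    (i j : Fin m) :
    Integrable (fun p : ℝ × ℝ => extKernel r Z i j p.1 p.2) (volume.prod volume) := by
  have h := hZ.integrable_prod hr hT i j
  rw [Measure.prod_restrict] at h
  exact (integrable_indicator_iff (measurableSet_Ioo.prod measurableSet_Ioo)).2 h

theorem extKernel_eq (i j : Fin m) (y : ℝ) :
    extKernel r Z i j y = fun u => (Ioo 0 r).indicator (fun y =>
      (Ioo 0 r).indicator (fun u => Z y u i j) u) y := by
  funext u
  by_cases h1 : y ∈ Ioo 0 r <;> by_cases h2 : u ∈ Ioo 0 r <;> simp [extKernel, h1, h2]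

theorem HasKernel.identity_of_mem_Icc (hZ : HasKernel Zop Z)
    (hT : T ∘L volterraOp m r + ContinuousLinearMap.adjoint (volterraOp m r) ∘L T = Zop)
    (i j : Fin m) {x t : ℝ} (hx : x ∈ Icc 0 r) (ht : t ∈ Icc 0 r) :
    Complex.I * (∫ u in t..r, cornerFun T i j x u) -
        Complex.I * (∫ y in x..r, cornerFun T i j y t) =
      ∫ y in Ioi x, ∫ u in Ioi t, extKernel r Z i j y u := by
  rw [← inner_stepVec_volterra_identity T i j hT hx ht,
    integral_congr_ae (ae_restrict_of_ae ((hZ.ae_stepVec i j t).mono fun y hy => hy.2)),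
    setIntegral_intervalMeasure _ measurableSet_Ioi]
  congr 1; funext y
  by_cases h1 : y ∈ Ioo 0 r
  · rw [indicator_of_mem h1, setIntegral_intervalMeasure _ measurableSet_Ioi]
    simp [extKernel_eq, h1]
  · simp [extKernel_eq, h1]

theorem HasKernel.identity (hZ : HasKernel Zop Z)
    (hT : T ∘L volterraOp m r + ContinuousLinearMap.adjoint (volterraOp m r) ∘L T = Zop)
    (i j : Fin m) {x t : ℝ} (hx : 0 ≤ x) (ht : 0 ≤ t) :
    Complex.I * (∫ u in t..r, cornerFun T i j x u) -
        Complex.I * (∫ y in x..r, cornerFun T i j y t) =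
      ∫ y in Ioi x, ∫ u in Ioi t, extKernel r Z i j y u := by
  rcases le_or_gt x r with hxr | hxr
  · rcases le_or_gt t r with htr | htr
    · exact hZ.identity_of_mem_Icc hT i j ⟨hx, hxr⟩ ⟨ht, htr⟩
    · have e1 : ∫ u in t..r, cornerFun T i j x u = 0 := by
        rw [intervalIntegral.integral_congr (g := fun _ => (0 : ℂ)), intervalIntegral.integral_zero]
        intro u hu
        rw [uIcc_of_ge htr.le] at hu
        exact cornerFun_of_le_right T i j x hu.1
      have e2 : ∀ y, ∫ u in Ioi t, extKernel r Z i j y u = 0 := fun y =>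
        setIntegral_eq_zero_of_forall_eq_zero fun u hu => by
          have : u ∉ Ioo 0 r := fun h => (htr.trans hu).not_gt h.2
          simp [extKernel, this]
      simp [e1, e2, cornerFun_of_le_right T i j _ htr.le]
  · have e1 : ∫ y in x..r, cornerFun T i j y t = 0 := by
      rw [intervalIntegral.integral_congr (g := fun _ => (0 : ℂ)), intervalIntegral.integral_zero]
      intro u hu
      rw [uIcc_of_ge hxr.le] at hu
      exact cornerFun_of_le_left T i j hu.1 t
    have e2 : ∫ y in Ioi x, ∫ u in Ioi t, extKernel r Z i j y u = 0 :=
      setIntegral_eq_zero_of_forall_eq_zero fun y hy => by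
        have : y ∉ Ioo 0 r := fun h => (hxr.trans hy).not_gt h.2
        simp [extKernel, this]
    simp [e1, e2, cornerFun_of_le_left T i j hxr.le]

end Kernel

theorem norm_sub_le_of_forall_small {E : Type*} [SeminormedAddCommGroup E] {F : ℝ → E} {g : ℝ → ℝ}
    {x δ : ℝ} (hx : 0 ≤ x) (hδ : 0 < δ)
    (h : ∀ a b, 0 ≤ a → a ≤ b → b ≤ x → b - a ≤ δ → ‖F b - F a‖ ≤ g b - g a) :
    ‖F x - F 0‖ ≤ g x - g 0 := by
  obtain ⟨n, hn⟩ := exists_nat_gt (x / δ)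
  have hn0 : (0 : ℝ) < n := lt_of_le_of_lt (by positivity) hn
  have hstep : x / n ≤ δ := by
    rw [div_lt_iff₀ hδ] at hn
    rw [div_le_iff₀ hn0]; linarith
  have key : ∀ k ∈ Finset.range n, ‖F ((k + 1 : ℕ) * (x / n)) - F (k * (x / n))‖ ≤
      g ((k + 1 : ℕ) * (x / n)) - g (k * (x / n)) := by
    intro k hk
    have hxn : 0 ≤ x / n := by positivity
    have hk' : ((k + 1 : ℕ) : ℝ) ≤ n := by exact_mod_cast Finset.mem_range.1 hk
    refine h _ _ (by positivity) ?_ ?_ ?_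
    · gcongr; exact_mod_cast Nat.le_succ k
    · calc ((k + 1 : ℕ) : ℝ) * (x / n) ≤ n * (x / n) := by gcongr
        _ = x := by field_simp
    · push_cast; linarith
  have e1 := Finset.sum_range_sub (fun k : ℕ => F (k * (x / n))) n
  have e2 := Finset.sum_range_sub (fun k : ℕ => g (k * (x / n))) n
  have hx' : (n : ℝ) * (x / n) = x := by field_simp
  simp only [hx', Nat.cast_zero, zero_mul] at e1 e2
  rw [← e1, ← e2]
  exact (norm_sum_le _ _).trans (Finset.sum_le_sum key)

section Shear

variable {K : ℝ → ℝ → ℂ}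

theorem integrable_shear (hK : Integrable (fun p : ℝ × ℝ => K p.1 p.2) (volume.prod volume)) :
    Integrable (fun p : ℝ × ℝ => K p.1 (p.2 - p.1)) (volume.prod volume) :=
  (measurePreserving_prod_sub volume volume).integrable_comp_of_integrable hK

theorem integral_Ioi_shear (f : ℝ → ℂ) (t y : ℝ) :
    ∫ u in Ioi t, f u = ∫ w in Ioi (t + y), f (w - y) := by
  rw [← integral_indicator measurableSet_Ioi, ← integral_indicator measurableSet_Ioi,
    ← integral_sub_right_eq_self _ y]
  congr 1; funext w
  by_cases h : t < w - y
  · rw [indicator_of_mem (by exact h), indicator_of_mem (by simp only [mem_Ioi]; linarith)]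
  · rw [indicator_of_notMem (by exact h), indicator_of_notMem (by simp only [mem_Ioi]; linarith)]

theorem integrable_integral_Ioi
    (hK : Integrable (fun p : ℝ × ℝ => K p.1 p.2) (volume.prod volume)) (t : ℝ) :
    Integrable fun y => ∫ u in Ioi t, K y u := by
  have h1 : Integrable (fun p : ℝ × ℝ => K p.1 p.2) (volume.prod (volume.restrict (Ioi t))) :=
    hK.mono_measure (Measure.prod_mono le_rfl Measure.restrict_le_self)
  exact h1.integral_prod_left

end Shear

section Characteristics

variable {Y K : ℝ → ℝ → ℂ} {r : ℝ}

theorem characteristic_increment (hY : Continuous fun p : ℝ × ℝ => Y p.1 p.2)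
    (hK : Integrable (fun p : ℝ × ℝ => K p.1 p.2) (volume.prod volume))
    (h : ∀ x t, 0 ≤ x → 0 ≤ t →
      Complex.I * (∫ u in t..r, Y x u) - Complex.I * (∫ y in x..r, Y y t) =
        ∫ y in Ioi x, ∫ u in Ioi t, K y u)
    {a b c : ℝ} (ha : 0 ≤ a) (hab : a ≤ b) (hbc : b ≤ c) :
    (Complex.I * ∫ u in (c - b)..r, Y b u) - (Complex.I * ∫ u in (c - a)..r, Y a u) =
      Complex.I * (∫ u in a..b, (Y a (c - u) - Y u (c - b))) -
        ∫ y in a..b, ∫ w in Ioi (c - b + y), K y (w - y) := by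
  have hc1 : ∀ z, Continuous (Y z) := fun z => hY.comp (by fun_prop : Continuous fun u => (z, u))
  have hc2 : ∀ z, Continuous fun y => Y y z :=
    fun z => hY.comp (by fun_prop : Continuous fun y : ℝ => (y, z))
  have hb := h b (c - b) (ha.trans hab) (by linarith)
  have ha' := h a (c - b) ha (by linarith)
  have hi := integrable_integral_Ioi hK (c - b)
  have e1 := intervalIntegral.integral_Ioi_sub_Ioi' (a := a) (b := b) hi.integrableOn
    hi.integrableOn
  have e2 : ∫ y in a..b, ∫ u in Ioi (c - b), K y u =
      ∫ y in a..b, ∫ w in Ioi (c - b + y), K y (w - y) := by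
    congr 1; funext y; exact integral_Ioi_shear _ _ _
  have e3 := intervalIntegral.integral_add_adjacent_intervals
    ((hc2 (c - b)).intervalIntegrable (μ := volume) a b)
    ((hc2 (c - b)).intervalIntegrable (μ := volume) b r)
  have e4 := intervalIntegral.integral_add_adjacent_intervals
    ((hc1 a).intervalIntegrable (μ := volume) (c - b) (c - a))
    ((hc1 a).intervalIntegrable (μ := volume) (c - a) r)
  have e5 : ∫ u in a..b, Y a (c - u) = ∫ u in (c - b)..(c - a), Y a u :=
    intervalIntegral.integral_comp_sub_left _ _
  have h6 : Continuous fun u => Y a (c - u) := (hc1 a).comp (by fun_prop)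
  rw [intervalIntegral.integral_sub (h6.intervalIntegrable _ _)
    ((hc2 _).intervalIntegrable _ _), e5, ← e2, ← e1, ← hb, ← ha', ← e3, ← e4]
  ring

theorem characteristic_small_increment (hY : Continuous fun p : ℝ × ℝ => Y p.1 p.2)
    (hK : Integrable (fun p : ℝ × ℝ => K p.1 p.2) (volume.prod volume))
    (h : ∀ x t, 0 ≤ x → 0 ≤ t →
      Complex.I * (∫ u in t..r, Y x u) - Complex.I * (∫ y in x..r, Y y t) =
        ∫ y in Ioi x, ∫ u in Ioi t, K y u)
    {a b c ε δ : ℝ} (ha : 0 ≤ a) (hab : a ≤ b) (hbc : b ≤ c) (hδ : b - a ≤ δ)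
    (hε : ∀ u ∈ Icc a b, ‖Y a (c - u) - Y u (c - b)‖ ≤ ε) :
    ‖((Complex.I * ∫ u in (c - b)..r, Y b u) + ∫ y in 0..b, ∫ w in Ioi c, K y (w - y)) -
      ((Complex.I * ∫ u in (c - a)..r, Y a u) + ∫ y in 0..a, ∫ w in Ioi c, K y (w - y))‖ ≤
      (ε * b + ∫ y in 0..b, ∫ w in Ioc (c - δ) c, ‖K y (w - y)‖) -
      (ε * a + ∫ y in 0..a, ∫ w in Ioc (c - δ) c, ‖K y (w - y)‖) := by
  have hS := integrable_shear hK
  have hV : Integrable fun y => ∫ w in Ioi c, K y (w - y) := integrable_integral_Ioi hS c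
  have hW : Integrable fun y => ∫ w in Ioi (c - b + y), K y (w - y) := by
    simpa only [← integral_Ioi_shear] using integrable_integral_Ioi hK (c - b)
  have hN : Integrable fun y => ∫ w in Ioc (c - δ) c, ‖K y (w - y)‖ := by
    have h1 : Integrable (fun p : ℝ × ℝ => ‖K p.1 (p.2 - p.1)‖)
        (volume.prod (volume.restrict (Ioc (c - δ) c))) :=
      hS.norm.mono_measure (Measure.prod_mono le_rfl Measure.restrict_le_self)
    exact h1.integral_prod_left
  have e1 := characteristic_increment hY hK h ha hab hbc
  have e2 := intervalIntegral.integral_interval_sub_left (a := 0) (b := b) (c := a)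
    (hV.intervalIntegrable) (hV.intervalIntegrable)
  have e3 := intervalIntegral.integral_interval_sub_left (a := 0) (b := b) (c := a)
    (hN.intervalIntegrable) (hN.intervalIntegrable)
  have e4 := intervalIntegral.integral_sub (hV.intervalIntegrable (a := a) (b := b))
    (hW.intervalIntegrable (a := a) (b := b))
  have b1 : ‖∫ u in a..b, (Y a (c - u) - Y u (c - b))‖ ≤ ε * (b - a) := by
    have := intervalIntegral.norm_integral_le_of_norm_le_const (a := a) (b := b) (C := ε)
      (f := fun u => Y a (c - u) - Y u (c - b)) fun u hu => by
        rw [uIoc_of_le hab] at hu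
        exact hε u ⟨hu.1.le, hu.2⟩
    rwa [abs_of_nonneg (sub_nonneg.2 hab)] at this
  have b2 : ‖∫ y in a..b, ((∫ w in Ioi c, K y (w - y)) - ∫ w in Ioi (c - b + y), K y (w - y))‖ ≤
      ∫ y in a..b, ∫ w in Ioc (c - δ) c, ‖K y (w - y)‖ := by
    refine intervalIntegral.norm_integral_le_of_norm_le hab ?_ hN.intervalIntegrable
    filter_upwards [hS.prod_right_ae] with y hy hyab
    rw [intervalIntegral.integral_Ioi_sub_Ioi' hy.integrableOn hy.integrableOn,
      intervalIntegral.integral_of_ge (by linarith [hyab.2]), norm_neg]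
    refine (norm_integral_le_integral_norm _).trans ?_
    exact setIntegral_mono_set hy.norm.integrableOn
      (Filter.Eventually.of_forall fun _ => norm_nonneg _)
      (LE.le.eventuallyLE (Ioc_subset_Ioc_left (by linarith [hyab.1])))
  calc _ = ‖Complex.I * (∫ u in a..b, (Y a (c - u) - Y u (c - b))) +
        ∫ y in a..b, ((∫ w in Ioi c, K y (w - y)) - ∫ w in Ioi (c - b + y), K y (w - y))‖ := by
        congr 1
        rw [e4, ← e2]
        linear_combination e1
    _ ≤ ε * (b - a) + ∫ y in a..b, ∫ w in Ioc (c - δ) c, ‖K y (w - y)‖ := by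
        refine (norm_add_le _ _).trans (add_le_add ?_ b2)
        rwa [norm_mul, Complex.norm_I, one_mul]
    _ = _ := by rw [← e3]; ring

theorem characteristic_integrated (hY : Continuous fun p : ℝ × ℝ => Y p.1 p.2)
    (hK : Integrable (fun p : ℝ × ℝ => K p.1 p.2) (volume.prod volume))
    (h : ∀ x t, 0 ≤ x → 0 ≤ t →
      Complex.I * (∫ u in t..r, Y x u) - Complex.I * (∫ y in x..r, Y y t) =
        ∫ y in Ioi x, ∫ u in Ioi t, K y u)
    {x c : ℝ} (hx : 0 ≤ x) (hxc : x ≤ c) :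
    (Complex.I * ∫ u in (c - x)..r, Y x u) + ∫ y in 0..x, ∫ w in Ioi c, K y (w - y) =
      Complex.I * ∫ u in c..r, Y 0 u := by
  have hS := integrable_shear hK
  have hk : Integrable fun w => ∫ y, ‖K y (w - y)‖ := hS.norm.integral_prod_right
  suffices hle : ∀ ε > 0, ‖((Complex.I * ∫ u in (c - x)..r, Y x u) +
      ∫ y in 0..x, ∫ w in Ioi c, K y (w - y)) - Complex.I * ∫ u in c..r, Y 0 u‖ ≤ ε * (x + 1) by
    rw [← sub_eq_zero, ← norm_le_zero_iff]
    refine le_of_forall_pos_le_add fun ε hε => ?_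
    have := hle (ε / (x + 1)) (by positivity)
    rwa [div_mul_cancel₀ _ (by positivity), ← zero_add ε] at this
  intro ε hε
  have huc := (isCompact_Icc.prod isCompact_Icc : IsCompact (Icc 0 c ×ˢ Icc 0 c)
    ).uniformContinuousOn_of_continuous hY.continuousOn
  rw [Metric.uniformContinuousOn_iff] at huc
  obtain ⟨δ₁, hδ₁, H₁⟩ := huc ε hε
  have hcont : Continuous fun s => ∫ w in s..c, ∫ y, ‖K y (w - y)‖ := by
    simp only [fun s => intervalIntegral.integral_symm (μ := volume)
      (f := fun w => ∫ y, ‖K y (w - y)‖) c s]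
    exact (intervalIntegral.continuous_primitive (fun _ _ => hk.intervalIntegrable) c).neg
  obtain ⟨δ₂, hδ₂, H₂⟩ := Metric.continuous_iff.1 hcont c ε hε
  set δ := min δ₁ δ₂ / 2 with hδdef
  have hδ : 0 < δ := by positivity
  have hδ1 : δ < δ₁ := by have := min_le_left δ₁ δ₂; have := lt_min hδ₁ hδ₂; linarith
  have hδ2 : δ < δ₂ := by have := min_le_right δ₁ δ₂; have := lt_min hδ₁ hδ₂; linarith
  have main := norm_sub_le_of_forall_small (x := x) (δ := δ)
    (F := fun x => (Complex.I * ∫ u in (c - x)..r, Y x u) +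
      ∫ y in 0..x, ∫ w in Ioi c, K y (w - y))
    (g := fun x => ε * x + ∫ y in 0..x, ∫ w in Ioc (c - δ) c, ‖K y (w - y)‖) hx hδ
    fun a b ha hab hbx hba => by
      refine characteristic_small_increment hY hK h ha hab (hbx.trans hxc) hba fun u hu => ?_
      rw [← dist_eq_norm]
      refine (H₁ (a, c - u) ⟨⟨ha, by linarith⟩, by linarith [hu.2], by linarith [hu.1]⟩
        (u, c - b) ⟨⟨by linarith [hu.1], by linarith [hu.2]⟩, by linarith, by linarith⟩ ?_).le
      rw [Prod.dist_eq, max_lt_iff, Real.dist_eq, Real.dist_eq, abs_lt, abs_lt]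
      dsimp only
      refine ⟨⟨?_, ?_⟩, ?_, ?_⟩ <;> linarith [hu.1, hu.2]
  simp only [intervalIntegral.integral_same, add_zero, mul_zero, sub_zero] at main
  refine main.trans ?_
  have hN : Integrable (fun p : ℝ × ℝ => ‖K p.1 (p.2 - p.1)‖)
      (volume.prod (volume.restrict (Ioc (c - δ) c))) :=
    hS.norm.mono_measure (Measure.prod_mono le_rfl Measure.restrict_le_self)
  have hlast : ∫ y in 0..x, ∫ w in Ioc (c - δ) c, ‖K y (w - y)‖ ≤ ε := by
    calc ∫ y in 0..x, ∫ w in Ioc (c - δ) c, ‖K y (w - y)‖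
        ≤ ∫ y, ∫ w in Ioc (c - δ) c, ‖K y (w - y)‖ := by
          rw [intervalIntegral.integral_of_le hx]
          exact setIntegral_le_integral hN.integral_prod_left
            (Filter.Eventually.of_forall fun _ => integral_nonneg fun _ => norm_nonneg _)
      _ = ∫ w in (c - δ)..c, ∫ y, ‖K y (w - y)‖ := by
          rw [intervalIntegral.integral_of_le (by linarith)]
          exact integral_integral_swap (f := fun y w => ‖K y (w - y)‖) hN
      _ ≤ ε := by
          have := H₂ (c - δ) (by rw [Real.dist_eq, sub_sub_cancel_left, abs_neg, abs_of_pos hδ]; exact hδ2)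
          rw [intervalIntegral.integral_same, dist_zero_right] at this
          exact (le_abs_self _).trans this.le
  linarith

/-- Integrating `i (∂ₜ - ∂ₓ) Y = K` along the characteristics `x + t = c`, in weak form. -/
theorem ae_eq_add_integral_characteristic (hY : Continuous fun p : ℝ × ℝ => Y p.1 p.2)
    (hK : Integrable (fun p : ℝ × ℝ => K p.1 p.2) (volume.prod volume))
    (h : ∀ x t, 0 ≤ x → 0 ≤ t →
      Complex.I * (∫ u in t..r, Y x u) - Complex.I * (∫ y in x..r, Y y t) =
        ∫ y in Ioi x, ∫ u in Ioi t, K y u)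
    {x : ℝ} (hx : 0 ≤ x) :
    ∀ᵐ c, x < c → Y x (c - x) = Y 0 c + Complex.I * ∫ y in 0..x, K y (c - y) := by
  have hc1 : ∀ z, Continuous (Y z) := fun z => hY.comp (by fun_prop : Continuous fun u => (z, u))
  have hS := integrable_shear hK
  have hS' : Integrable (fun p : ℝ × ℝ => K p.1 (p.2 - p.1))
      ((volume.restrict (Ioc 0 x)).prod volume) :=
    hS.mono_measure (Measure.prod_mono Measure.restrict_le_self le_rfl)
  have hq : Integrable fun w => ∫ y in Ioc 0 x, K y (w - y) := hS'.integral_prod_right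
  have hswap : ∀ c, ∫ y in 0..x, ∫ w in Ioi c, K y (w - y) =
      ∫ w in Ioi c, ∫ y in Ioc 0 x, K y (w - y) := fun c => by
    rw [intervalIntegral.integral_of_le hx]
    exact integral_integral_swap (f := fun y w => K y (w - y))
      (hS'.mono_measure (Measure.prod_mono le_rfl Measure.restrict_le_self))
  have hd : ∀ z s : ℝ, HasDerivAt (fun t => ∫ u in t..r, Y z u) (-Y z s) s := fun z s =>
    intervalIntegral.integral_hasDerivAt_left ((hc1 z).intervalIntegrable _ _)
      (hc1 z).stronglyMeasurable.stronglyMeasurableAtFilter (hc1 z).continuousAt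
  filter_upwards [ae_hasDerivAt_integral_Ioi hq] with c hc hxc
  have d1 : HasDerivAt (fun c => (Complex.I * ∫ u in (c - x)..r, Y x u) +
      ∫ w in Ioi c, ∫ y in Ioc 0 x, K y (w - y))
      (Complex.I * (-Y x (c - x)) + -∫ y in Ioc 0 x, K y (c - y)) c := by
    have := (hd x (c - x)).comp_sub_const c x
    exact (this.const_mul Complex.I).add hc
  have d2 : HasDerivAt (fun c => Complex.I * ∫ u in c..r, Y 0 u) (Complex.I * (-Y 0 c)) c :=
    (hd 0 c).const_mul Complex.I
  have heq : (fun c => (Complex.I * ∫ u in (c - x)..r, Y x u) +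
      ∫ w in Ioi c, ∫ y in Ioc 0 x, K y (w - y)) =ᶠ[nhds c]
      fun c => Complex.I * ∫ u in c..r, Y 0 u := by
    filter_upwards [Ioi_mem_nhds hxc] with c' hc'
    rw [← hswap, characteristic_integrated hY hK h hx hc'.le]
  have := d1.unique (d2.congr_of_eventuallyEq heq)
  rw [intervalIntegral.integral_of_le hx]
  linear_combination Complex.I * this + (Y x (c - x) - Y 0 c) * Complex.I_sq

end Characteristics

section Representation

variable {m : ℕ} {r : ℝ} {Z : ℝ → ℝ → Matrix (Fin m) (Fin m) ℂ}

/-- The matrix function with entries `cornerFun T i j`. -/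
noncomputable def cornerMatrix (T : L2Vec m r →L[ℂ] L2Vec m r) (x t : ℝ) :
    Matrix (Fin m) (Fin m) ℂ :=
  Matrix.of fun i j => cornerFun T i j x t

variable (T : L2Vec m r →L[ℂ] L2Vec m r)

theorem partialT_cornerMatrix (x t : ℝ) (i j : Fin m) :
    partialT (cornerMatrix T) x t i j = deriv (cornerFun T i j x) t := rfl

theorem integral_partialT_cornerMatrix (f : L2Vec m r) (x : ℝ) :
    ∫ t, Matrix.toEuclideanLin (partialT (cornerMatrix T) x t) (f t) ∂(intervalMeasure r) =
      -∫ u in Ioi x, T f u ∂(intervalMeasure r) := by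
  have hae : ∀ i, (fun t => Matrix.toEuclideanLin (partialT (cornerMatrix T) x t) (f t) i)
      =ᵐ[intervalMeasure r] fun t =>
        -inner ℂ (ContinuousLinearMap.adjoint T (stepVec r i x) t) (f t) := by
    intro i
    filter_upwards [ae_all_iff.2 fun j => ae_deriv_cornerFun_right T i j x] with t ht
    simp only [Matrix.toLpLin_apply, Matrix.mulVec, dotProduct, partialT_cornerMatrix, ht, rowFun,
      PiLp.inner_apply, neg_mul, Finset.sum_neg_distrib, RCLike.inner_apply,
      mul_comm (starRingEnd ℂ _)]
  have hint : ∀ i, Integrable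
      (fun t => Matrix.toEuclideanLin (partialT (cornerMatrix T) x t) (f t) i)
      (intervalMeasure r) := fun i => (L2.integrable_inner _ f).neg.congr (hae i).symm
  ext i
  rw [eval_integral_piLp hint, integral_congr_ae (hae i), integral_neg, ← L2.inner_def,
    ContinuousLinearMap.adjoint_inner_left, inner_stepVec, PiLp.neg_apply,
    eval_integral_piLp fun i => ((T f).integrable_apply i).integrableOn]

theorem isDerivOfIntegral_cornerMatrix : IsDerivOfIntegral T (partialT (cornerMatrix T)) := by
  intro f
  simp only [integral_partialT_cornerMatrix]
  refine ⟨(absolutelyContinuousOnInterval_integral_Ioi_intervalMeasure (T f).integrable 0 r).neg,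
    ?_⟩
  filter_upwards [ae_hasDerivAt_integral_Ioi_intervalMeasure (T f).integrable] with x hx
  have h := hx.neg
  rwa [neg_neg] at h

theorem memLp_cornerFun (i j : Fin m) (x : ℝ) :
    MemLp (cornerFun T i j x) 2 (intervalMeasure r) := by
  have hc : Continuous (cornerFun T i j x) := by
    have h := (continuous_cornerFun T i j).comp (by fun_prop : Continuous fun t : ℝ => (x, t))
    simpa only [Function.comp_def] using h
  refine MemLp.of_bound hc.aestronglyMeasurable ((intervalMeasure r).real univ ^ (1 / 2 : ℝ) *
    (‖T‖ * (intervalMeasure r).real univ ^ (1 / 2 : ℝ))) (Filter.Eventually.of_forall fun t => ?_)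
  refine (norm_inner_le_norm _ _).trans ?_
  gcongr
  · exact norm_stepVec_le r i x
  · exact (T.le_opNorm _).trans (by gcongr; exact norm_stepVec_le r j t)

theorem antidiagEntry_eq (x t : ℝ) (i j : Fin m) :
    antidiagEntry Z x t i j = fun s => (fun y => Z y (x + t - y) i j) (s / 2 + (x + t) / 2) := by
  funext s
  simp only [antidiagEntry]
  congr 2 <;> ring

theorem antidiag_lower_limit (r x t : ℝ) :
    -min (x + t) (2 * r - x - t) / 2 + (x + t) / 2 = max 0 (x + t - r) := by
  rcases le_total (x + t) (2 * r - x - t) with h | h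
  · rw [min_eq_left h, max_eq_left (by linarith)]; ring
  · rw [min_eq_right h, max_eq_right (by linarith)]; ring

theorem upsilonFormula_apply (r : ℝ) (υ : ℝ → Matrix (Fin m) (Fin m) ℂ) (x t : ℝ) (i j : Fin m) :
    upsilonFormula r Z υ x t i j =
      υ (x + t) i j + Complex.I * ∫ y in (max 0 (x + t - r))..x, Z y (x + t - y) i j := by
  simp only [upsilonFormula, Matrix.of_apply]
  rw [antidiagEntry_eq, intervalIntegral.integral_comp_div_add _ (two_ne_zero' ℝ),
    antidiag_lower_limit, show (x - t) / 2 + (x + t) / 2 = x by ring, Complex.real_smul]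
  push_cast
  ring

theorem intervalIntegrable_antidiagEntry {x t : ℝ} {i j : Fin m}
    (h : IntervalIntegrable (fun y => Z y (x + t - y) i j) volume (max 0 (x + t - r)) x) :
    IntervalIntegrable (antidiagEntry Z x t i j) volume (-min (x + t) (2 * r - x - t)) (x - t) := by
  rw [antidiagEntry_eq]
  have h1 := (h.comp_add_right ((x + t) / 2)).comp_mul_left (c := (1 / 2 : ℝ))
  rw [← antidiag_lower_limit] at h1
  convert h1 using 1
  · funext s; simp only [div_eq_inv_mul, mul_one]
  · ring
  · ring

theorem extKernel_antidiagonal {x c y : ℝ} (hx : x ∈ Icc 0 r) (hc : x ≤ c) (i j : Fin m)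
    (hy : y ∈ Ioo 0 x) :
    extKernel r Z i j y (c - y) = (Ioi (c - r)).indicator (fun y => Z y (c - y) i j) y := by
  have h1 : y ∈ Ioo 0 r := ⟨hy.1, hy.2.trans_le hx.2⟩
  by_cases h : y ∈ Ioi (c - r)
  · have h2 : c - y ∈ Ioo 0 r := ⟨by linarith [hy.2], by simp only [mem_Ioi] at h; linarith⟩
    simp only [extKernel]
    rw [indicator_of_mem (mk_mem_prod h1 h2), indicator_of_mem h]
  · have h2 : c - y ∉ Ioo 0 r := fun h' => h (by simp only [mem_Ioi]; linarith [h'.2])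
    simp only [extKernel]
    rw [indicator_of_notMem (fun h' => h2 h'.2), indicator_of_notMem h]

theorem integral_extKernel_antidiagonal {x c : ℝ} (hx : x ∈ Icc 0 r) (hc : x ≤ c) (hcr : c - r ≤ x)
    (i j : Fin m) :
    ∫ y in 0..x, extKernel r Z i j y (c - y) = ∫ y in (max 0 (c - r))..x, Z y (c - y) i j := by
  rw [intervalIntegral.integral_of_le hx.1, intervalIntegral.integral_of_le (max_le hx.1 hcr),
    integral_Ioc_eq_integral_Ioo, integral_Ioc_eq_integral_Ioo,
    setIntegral_congr_fun measurableSet_Ioo fun y hy => extKernel_antidiagonal hx hc i j hy,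
    setIntegral_indicator measurableSet_Ioi, Ioo_inter_Ioi]

theorem intervalIntegrable_of_extKernel {x c : ℝ} (hx : x ∈ Icc 0 r) (hc : x ≤ c)
    (hcr : c - r ≤ x) {i j : Fin m} (h : Integrable fun y => extKernel r Z i j y (c - y)) :
    IntervalIntegrable (fun y => Z y (c - y) i j) volume (max 0 (c - r)) x := by
  rw [intervalIntegrable_iff_integrableOn_Ioo_of_le (max_le hx.1 hcr)]
  have h1 : IntegrableOn (fun y => extKernel r Z i j y (c - y)) (Ioo (max 0 (c - r)) x) :=
    h.integrableOn
  refine h1.congr_fun (fun y hy => ?_) measurableSet_Ioo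
  have h2 := max_lt_iff.1 hy.1
  dsimp only
  rw [extKernel_antidiagonal hx hc i j ⟨h2.1, hy.2⟩, indicator_of_mem (show y ∈ Ioi (c - r) from h2.2)]

end Representation

section Regular

variable {m : ℕ} {r : ℝ} {Z : ℝ → ℝ → Matrix (Fin m) (Fin m) ℂ}

theorem IsRegularKernel.aestronglyMeasurable_antidiagonal (h : IsRegularKernel r Z) (i j : Fin m)
    {x t : ℝ} (hx : x ∈ Icc 0 r) (ht : t ∈ Icc 0 r) :
    AEStronglyMeasurable ((Ioi (x + t - r)).indicator fun y => Z y (x + t - y) i j)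
      (volume.restrict (Ioo 0 x)) := by
  rw [aestronglyMeasurable_indicator_iff measurableSet_Ioi,
    Measure.restrict_restrict measurableSet_Ioi]
  have hS : ((Ioi (x + t - r) ∩ Ioo 0 x) \ {(x + t) / 2} : Set ℝ) =ᵐ[volume]
      (Ioi (x + t - r) ∩ Ioo 0 x : Set ℝ) :=
    sdiff_null_ae_eq_self (measure_singleton _)
  rw [← Measure.restrict_congr_set hS]
  refine ContinuousOn.aestronglyMeasurable ?_
    ((measurableSet_Ioi.inter measurableSet_Ioo).diff (measurableSet_singleton _))
  refine (h.2 i j).comp (f := fun y => (y, x + t - y)) (by fun_prop) fun y hy => ?_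
  obtain ⟨⟨h1, h2, h3⟩, h4⟩ := hy
  simp only [mem_Ioi, mem_singleton_iff] at h1 h4
  exact ⟨⟨h2.le, h3.le.trans hx.2⟩, ⟨by dsimp only; linarith [ht.1], by dsimp only; linarith⟩,
    fun h5 => h4 (by dsimp only at h5; linarith)⟩

theorem IsRegularKernel.continuousOn_antidiagonal (h : IsRegularKernel r Z) (i j : Fin m)
    {x : ℝ} (hx : x ∈ Icc 0 r) :
    ContinuousOn (fun t => ∫ y in (max 0 (x + t - r))..x, Z y (x + t - y) i j) (Icc 0 r) := by
  obtain ⟨C, hC⟩ := h.1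
  have heq : EqOn (fun t => ∫ y in (max 0 (x + t - r))..x, Z y (x + t - y) i j)
      (fun t => ∫ y in Ioo 0 x, (Ioi (x + t - r)).indicator (fun y => Z y (x + t - y) i j) y)
      (Icc 0 r) := fun t ht => by
    dsimp only
    rw [intervalIntegral.integral_of_le (max_le hx.1 (by linarith [ht.2])),
      integral_Ioc_eq_integral_Ioo, setIntegral_indicator measurableSet_Ioi, Ioo_inter_Ioi]
  refine ContinuousOn.congr (fun t₀ ht₀ => ?_) heq
  refine continuousWithinAt_of_dominated (bound := fun _ => max C 0) ?_ ?_
    (integrable_const _) ?_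
  · filter_upwards [self_mem_nhdsWithin] with t ht
    exact h.aestronglyMeasurable_antidiagonal i j hx ht
  · filter_upwards [self_mem_nhdsWithin] with t ht
    filter_upwards [ae_restrict_mem measurableSet_Ioo] with y hy
    by_cases hyt : y ∈ Ioi (x + t - r)
    · rw [indicator_of_mem hyt]
      simp only [mem_Ioi] at hyt
      exact (hC y ⟨hy.1.le, hy.2.le.trans hx.2⟩ (x + t - y)
        ⟨by linarith [hy.2, ht.1], by linarith⟩ i j).trans (le_max_left _ _)
    · rw [indicator_of_notMem hyt, norm_zero]; exact le_max_right _ _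
  · have hne : ∀ a : ℝ, ∀ᵐ y ∂(volume.restrict (Ioo 0 x)), y ≠ a := fun a =>
      ae_restrict_of_ae (by simp [ae_iff])
    filter_upwards [ae_restrict_mem measurableSet_Ioo, hne (x + t₀ - r), hne ((x + t₀) / 2)]
      with y hy hy1 hy2
    rcases lt_or_gt_of_ne hy1 with hlt | hgt
    · have hev : (fun t => (Ioi (x + t - r)).indicator (fun y => Z y (x + t - y) i j) y)
          =ᶠ[nhds t₀] fun _ => 0 := by
        have : ∀ᶠ t in nhds t₀, y - x + r < t := Ioi_mem_nhds (by linarith)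
        filter_upwards [this] with t ht
        exact indicator_of_notMem (by simp only [mem_Ioi]; linarith) _
      exact (continuousAt_const.congr hev.symm).continuousWithinAt
    · have hsq : ∀ᶠ t in nhdsWithin t₀ (Icc 0 r), y ∈ Ioi (x + t - r) ∧
          (y, x + t - y) ∈ {p : ℝ × ℝ | p.1 ∈ Icc 0 r ∧ p.2 ∈ Icc 0 r ∧ p.1 ≠ p.2} := by
        have e1 : ∀ᶠ t in nhds t₀, t < y - x + r := Iio_mem_nhds (by linarith)
        have e2 : ∀ᶠ t in nhds t₀, t ≠ 2 * y - x :=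
          isOpen_ne.mem_nhds fun h3 => hy2 (by linarith)
        filter_upwards [self_mem_nhdsWithin, mem_nhdsWithin_of_mem_nhds e1,
          mem_nhdsWithin_of_mem_nhds e2] with t ht h1 h2
        refine ⟨by simp only [mem_Ioi]; linarith, ⟨hy.1.le, hy.2.le.trans hx.2⟩,
          ⟨?_, ?_⟩, fun h3 => h2 ?_⟩
        · linarith [hy.2, ht.1]
        · linarith
        · linarith
      have hpt := hsq.self_of_nhdsWithin ht₀
      have hcomp : ContinuousWithinAt (fun t => Z y (x + t - y) i j) (Icc 0 r) t₀ := by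
        have hcw := (h.2 i j) (y, x + t₀ - y) hpt.2
        refine Filter.Tendsto.comp (f := fun t => (y, x + t - y)) hcw ?_
        refine tendsto_nhdsWithin_iff.2 ⟨?_, hsq.mono fun _ h => h.2⟩
        have : Continuous fun t : ℝ => (y, x + t - y) := by fun_prop
        exact this.continuousAt.continuousWithinAt
      refine hcomp.congr_of_eventuallyEq ?_ (indicator_of_mem hpt.1 _)
      filter_upwards [hsq] with t ht
      exact indicator_of_mem ht.1 _

end Regular

section Main

variable {m : ℕ} {r : ℝ} {T Zop : L2Vec m r →L[ℂ] L2Vec m r}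
  {Z : ℝ → ℝ → Matrix (Fin m) (Fin m) ℂ}

theorem HasKernel.ae_characteristic (hr : 0 < r) (hZ : HasKernel Zop Z)
    (hT : T ∘L volterraOp m r + ContinuousLinearMap.adjoint (volterraOp m r) ∘L T = Zop)
    {x : ℝ} (hx : x ∈ Icc 0 r) :
    ∀ᵐ c, x < c → c - r ≤ x → ∀ i j,
      IntervalIntegrable (fun y => Z y (c - y) i j) volume (max 0 (c - r)) x ∧
      cornerFun T i j x (c - x) = cornerFun T i j 0 c +
        Complex.I * ∫ y in (max 0 (c - r))..x, Z y (c - y) i j := by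
  have h1 : ∀ᵐ c, ∀ i j, x < c → cornerFun T i j x (c - x) = cornerFun T i j 0 c +
      Complex.I * ∫ y in 0..x, extKernel r Z i j y (c - y) :=
    ae_all_iff.2 fun i => ae_all_iff.2 fun j =>
      ae_eq_add_integral_characteristic (continuous_cornerFun T i j)
        (hZ.integrable_extKernel hr hT i j) (fun x t hx ht => hZ.identity hT i j hx ht) hx.1
  have h2 : ∀ᵐ c, ∀ i j, Integrable fun y => extKernel r Z i j y (c - y) :=
    ae_all_iff.2 fun i => ae_all_iff.2 fun j =>
      (integrable_shear (hZ.integrable_extKernel hr hT i j)).prod_left_ae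
  filter_upwards [h1, h2] with c h1 h2 hxc hcr i j
  refine ⟨intervalIntegrable_of_extKernel hx hxc.le hcr (h2 i j), ?_⟩
  rw [h1 i j hxc, integral_extKernel_antidiagonal hx hxc.le hcr]

theorem HasKernel.ae_upsilonFormula (hr : 0 < r) (hZ : HasKernel Zop Z)
    (hT : T ∘L volterraOp m r + ContinuousLinearMap.adjoint (volterraOp m r) ∘L T = Zop)
    {x : ℝ} (hx : x ∈ Icc 0 r) :
    ∀ᵐ t ∂(intervalMeasure r),
      (∀ i j, IntervalIntegrable (antidiagEntry Z x t i j) volume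
        (-min (x + t) (2 * r - x - t)) (x - t)) ∧
      cornerMatrix T x t = upsilonFormula r Z (cornerMatrix T 0) x t := by
  have h := (measurePreserving_add_left volume x).quasiMeasurePreserving.ae
    (hZ.ae_characteristic hr hT hx)
  filter_upwards [ae_restrict_of_ae h, ae_restrict_mem measurableSet_Ioo] with t ht htr
  have h1 := ht (by linarith [htr.1]) (by linarith [htr.2])
  refine ⟨fun i j => intervalIntegrable_antidiagEntry (h1 i j).1, ?_⟩
  ext i j
  have h2 := (h1 i j).2
  rw [add_sub_cancel_left] at h2
  rw [upsilonFormula_apply]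
  exact h2

theorem HasKernel.upsilonFormula_of_isRegularKernel (hr : 0 < r) (hZ : HasKernel Zop Z)
    (hT : T ∘L volterraOp m r + ContinuousLinearMap.adjoint (volterraOp m r) ∘L T = Zop)
    (hreg : IsRegularKernel r Z) {x t : ℝ} (hx : x ∈ Icc 0 r) (ht : t ∈ Icc 0 r) :
    cornerMatrix T x t = upsilonFormula r Z (cornerMatrix T 0) x t := by
  ext i j
  have hc : ∀ z, Continuous (cornerFun T i j z) := fun z => by
    have h := (continuous_cornerFun T i j).comp (by fun_prop : Continuous fun t : ℝ => (z, t))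
    simpa only [Function.comp_def] using h
  have hae : (fun t => cornerFun T i j x t) =ᵐ[volume.restrict (Icc 0 r)]
      fun t => upsilonFormula r Z (cornerMatrix T 0) x t i j := by
    rw [← Measure.restrict_congr_set Ioo_ae_eq_Icc]
    filter_upwards [hZ.ae_upsilonFormula hr hT hx] with t ht
    exact congrFun (congrFun ht.2 i) j
  refine Measure.eqOn_Icc_of_ae_eq volume hr.ne hae (hc x).continuousOn ?_ ht
  simp only [upsilonFormula_apply]
  exact ((hc 0).comp (continuous_const.add continuous_id)).continuousOn.add
    (continuousOn_const.mul (hreg.continuousOn_antidiagonal i j hx))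

theorem integral_antidiagonal_comm (i j : Fin m) (ξ : ℝ) :
    ∫ t in (ξ - r)..r, Z (ξ - t) t i j = ∫ y in (ξ - r)..r, Z y (ξ - y) i j := by
  have h := intervalIntegral.integral_comp_sub_left (a := ξ - r) (b := r)
    (fun y => Z y (ξ - y) i j) ξ
  simpa only [sub_sub_cancel] using h

theorem HasKernel.ae_integral_antidiagonal_eq_zero (hr : 0 < r) (hZ : HasKernel Zop Z)
    (hT : T ∘L volterraOp m r + ContinuousLinearMap.adjoint (volterraOp m r) ∘L T = Zop) :
    ∀ᵐ ξ ∂(volume.restrict (Icc r (2 * r))), ∀ i j,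
      IntervalIntegrable (fun t => Z (ξ - t) t i j) volume (ξ - r) r ∧
      ∫ t in (ξ - r)..r, Z (ξ - t) t i j = 0 := by
  rw [← Measure.restrict_congr_set Ioc_ae_eq_Icc]
  filter_upwards [ae_restrict_of_ae (hZ.ae_characteristic hr hT ⟨hr.le, le_rfl⟩),
    ae_restrict_mem measurableSet_Ioc] with ξ h hξ i j
  obtain ⟨h1, h2⟩ := h hξ.1 (by linarith [hξ.2]) i j
  rw [max_eq_right (by linarith [hξ.1])] at h1 h2
  rw [cornerFun_of_le_left T i j le_rfl, cornerFun_of_le_right T i j _ hξ.1.le, zero_add] at h2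
  refine ⟨?_, ?_⟩
  · have h3 := (h1.comp_sub_left ξ).symm
    simpa only [sub_sub_cancel] using h3
  · rw [integral_antidiagonal_comm]
    exact (mul_eq_zero.1 h2.symm).resolve_left Complex.I_ne_zero

theorem HasKernel.integral_antidiagonal_eq_zero (hr : 0 < r) (hZ : HasKernel Zop Z)
    (hT : T ∘L volterraOp m r + ContinuousLinearMap.adjoint (volterraOp m r) ∘L T = Zop)
    (hreg : IsRegularKernel r Z) {ξ : ℝ} (hξ : ξ ∈ Icc r (2 * r)) (i j : Fin m) :
    ∫ t in (ξ - r)..r, Z (ξ - t) t i j = 0 := by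
  have h := congrFun (congrFun (hZ.upsilonFormula_of_isRegularKernel hr hT hreg
    (x := r) (t := ξ - r) ⟨hr.le, le_rfl⟩ ⟨by linarith [hξ.1], by linarith [hξ.2]⟩) i) j
  rw [upsilonFormula_apply, add_sub_cancel, max_eq_right (by linarith [hξ.1])] at h
  simp only [cornerMatrix, Matrix.of_apply, cornerFun_of_le_left T i j le_rfl,
    cornerFun_of_le_right T i j _ hξ.1, zero_add] at h
  rw [integral_antidiagonal_comm]
  exact (mul_eq_zero.1 h.symm).resolve_left Complex.I_ne_zero

end Main

theorem theorem4p1 (m : ℕ) (r : ℝ) (hr : 0 < r) (T Zop : L2Vec m r →L[ℂ] L2Vec m r)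
    (Z : ℝ → ℝ → Matrix (Fin m) (Fin m) ℂ) (hZ : HasKernel Zop Z)
    (hT : T ∘L volterraOp m r + ContinuousLinearMap.adjoint (volterraOp m r) ∘L T = Zop) :
    -- the representation of `T`
    (∃ (υ : ℝ → Matrix (Fin m) (Fin m) ℂ) (Υ : ℝ → ℝ → Matrix (Fin m) (Fin m) ℂ),
      (∀ i j, MemLp (fun ξ => υ ξ i j) 2 (intervalMeasure r)) ∧
      (∀ ξ ∈ Icc r (2 * r), υ ξ = 0) ∧
      (∀ x ∈ Icc 0 r, ∀ᵐ t ∂(intervalMeasure r),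
        (∀ i j, IntervalIntegrable (antidiagEntry Z x t i j) volume
          (-min (x + t) (2 * r - x - t)) (x - t)) ∧
        Υ x t = upsilonFormula r Z υ x t) ∧
      (IsRegularKernel r Z → ∀ x ∈ Icc 0 r, ∀ t ∈ Icc 0 r, Υ x t = upsilonFormula r Z υ x t) ∧
      (∀ x ∈ Icc 0 r, ∀ i j, AbsolutelyContinuousOnInterval (fun t => Υ x t i j) 0 r ∧
        MemLp (fun t => partialT Υ x t i j) 2 (intervalMeasure r)) ∧
      IsDerivOfIntegral T (partialT Υ)) ∧
    -- the condition on the kernel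
    (∀ᵐ ξ ∂(volume.restrict (Icc r (2 * r))), ∀ i j,
      IntervalIntegrable (fun t => Z (ξ - t) t i j) volume (ξ - r) r ∧
      ∫ t in (ξ - r)..r, Z (ξ - t) t i j = 0) ∧
    (IsRegularKernel r Z → ∀ ξ ∈ Icc r (2 * r), ∀ i j,
      ∫ t in (ξ - r)..r, Z (ξ - t) t i j = 0) := by

  refine ⟨⟨cornerMatrix T 0, cornerMatrix T, fun i j => memLp_cornerFun T i j 0, fun ξ hξ => ?_,
    fun x hx => hZ.ae_upsilonFormula hr hT hx,
    fun hreg x hx t ht => hZ.upsilonFormula_of_isRegularKernel hr hT hreg hx ht,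
    fun x _ i j => ⟨?_, ?_⟩, isDerivOfIntegral_cornerMatrix T⟩,
    hZ.ae_integral_antidiagonal_eq_zero hr hT,
    fun hreg ξ hξ i j => hZ.integral_antidiagonal_eq_zero hr hT hreg hξ i j⟩
  · ext i j
    exact cornerFun_of_le_right T i j 0 hξ.1
  · simp only [cornerMatrix, Matrix.of_apply, cornerFun_eq_integral_right]
    exact absolutelyContinuousOnInterval_integral_Ioi_intervalMeasure
      (integrable_rowFun T i j x) 0 r
  · exact (memLp_rowFun T i j x).neg.ae_eq (ae_deriv_cornerFun_right T i j x).symm
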